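/- Let $k\ge 1$, $\ell\ge 2$ and let $v=v(1)\cdots v(\ell)\in[k]^\ell$ be a pattern with exactly $d$ distinct letters, $[k]=\{1,\dots,k\}$. An occurrence of $v$ in a word $w\in[k]^n$ is a sequence $1\le j_1<\dots<j_\ell\le n$ such that, for all $p,q$, $w(j_p)<w(j_q)\iff v(p)<v(q)$ and $w(j_p)=w(j_q)\iff v(p)=v(q)$; $occ_v(w)$ is the number of occurrences. For $r\ge 0$ let $f_r^v(k,n)=\#\{w\in[k]^n: occ_v(w)=r\}$ and $g_r^v(k,n)=\sum_{j=0}^r f_j^v(k,n)$. Call words $w,w'\in[k]^*$ equivalent if for every $u\in[k]^*$ and every $m\le r$ one has $occ_v(w'u)=m\iff occ_v(wu)=m$, and let $\langle w\rangle$ be the class of $w$. The automaton $Au(v,r,k)$ has as states the classes $\langle w\rangle$ with $occ_v(w)\le r$, the initial state $\langle\epsilon\rangle$ ($\epsilon$ the empty word), and an edge labelled $a\in[k]$ from $\langle w\rangle$ to $\langle wa\rangle$ whenever both are states; all states are final. A loop is a labelled edge from a state to itself; a simple path is a finite sequence of pairwise distinct states, starting at $\langle\epsilon\rangle$, in which consecutive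 states are joined by an edge. Assume $d>1$ and let $r\ge 0$. Then the number of states with exactly $d-1$ loops on a simple path of $Au(v,r,k)$ attains a maximum; write this maximum as $M_r+1$. Then $M_r\ge 1$, and there are real constants $C_r\in(0,\infty)$ and $K_r\ge 0$ such that $$\lim_{n\to\infty}\frac{g_r^v(k,n)}{n^{M_r}(d-1)^n}=C_r\qquad\text{and}\qquad \lim_{n\to\infty}\frac{f_r^v(k,n)}{n^{M_r}(d-1)^n}=K_r .$$ -/

import Mathlib

/-
Reading letters can only increase the numbers of occurrences in the continuations of a word, cut off
at `r + 1`, so the states are partially ordered by them and the edges of the automaton ascend. Hence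
its adjacency matrix, divided by `d - 1`, is triangular; its diagonal entries are at most `1`, since
`d` loops at a state would allow a copy of the pattern to be appended without changing the class.
Each state with diagonal entry `1` acts as a summation operator and raises the polynomial order of
growth by one, and each other state acts as a convergent geometric series and preserves it. So the
entries of the `n`-th power grow like `n ^ (m - 1)`, where `m` is the largest number of states with
`d - 1` loops on a path.
-/

namespace PatternWords

/-- The occurrences of the pattern `v` in the word `w`: increasing sequences of positions of `w`
whose letters are order-isomorphic to `v`. -/
abbrev Occurrence {k ℓ : ℕ} (v : Fin ℓ → Fin k) (w : List (Fin k)) : Type :=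
  {j : Fin ℓ ↪o Fin w.length // ∀ p q : Fin ℓ,
    (w.get (j p) < w.get (j q) ↔ v p < v q) ∧ (w.get (j p) = w.get (j q) ↔ v p = v q)}

/-- The number of occurrences of `v` in `w`. -/
noncomputable def occ {k ℓ : ℕ} (v : Fin ℓ → Fin k) (w : List (Fin k)) : ℕ :=
  Nat.card (Occurrence v w)

/-- The number of words of length `n` over `[k]` with exactly `r` occurrences of `v`. -/
noncomputable def f {k ℓ : ℕ} (v : Fin ℓ → Fin k) (r n : ℕ) : ℕ :=
  Set.ncard {w : List (Fin k) | w.length = n ∧ occ v w = r}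

/-- The number of words of length `n` over `[k]` with at most `r` occurrences of `v`. -/
noncomputable def g {k ℓ : ℕ} (v : Fin ℓ → Fin k) (r n : ℕ) : ℕ :=
  ∑ j ∈ Finset.range (r + 1), f v j n

/-- The number of distinct letters of `v`. -/
def numLetters {k ℓ : ℕ} (v : Fin ℓ → Fin k) : ℕ :=
  (Finset.univ.image v).card

/-- Two words are equivalent if, for every continuation `u` and every `m ≤ r`, one of them followed
by `u` has exactly `m` occurrences of `v` iff the other one has. -/
def wordSetoid {k ℓ : ℕ} (v : Fin ℓ → Fin k) (r : ℕ) : Setoid (List (Fin k)) where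
  r w' w := ∀ u : List (Fin k), ∀ m ≤ r, occ v (w' ++ u) = m ↔ occ v (w ++ u) = m
  iseqv :=
    { refl := fun _ _ _ _ => Iff.rfl
      symm := fun h u m hm => (h u m hm).symm
      trans := fun h₁ h₂ u m hm => (h₁ u m hm).trans (h₂ u m hm) }

/-- All equivalence classes of words. -/
abbrev WordClass {k ℓ : ℕ} (v : Fin ℓ → Fin k) (r : ℕ) : Type :=
  Quotient (wordSetoid v r)

/-- The class of a word. -/
def wordClass {k ℓ : ℕ} (v : Fin ℓ → Fin k) (r : ℕ) (w : List (Fin k)) : WordClass v r :=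
  Quotient.mk (wordSetoid v r) w

/-- The states of the automaton: the classes of the words with at most `r` occurrences of `v`.
Only the class of the words with more than `r` occurrences is left out. -/
abbrev State {k ℓ : ℕ} (v : Fin ℓ → Fin k) (r : ℕ) : Type :=
  {s : WordClass v r // ∃ w : List (Fin k), occ v w ≤ r ∧ wordClass v r w = s}

/-- The map `⟨w⟩ ↦ ⟨wa⟩` on classes. -/
def appendLetter {k ℓ : ℕ} (v : Fin ℓ → Fin k) (r : ℕ) (s : WordClass v r) (a : Fin k) :
    WordClass v r :=
  Quotient.map (sa := wordSetoid v r) (sb := wordSetoid v r) (fun w => w ++ [a])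
    (fun w' w h u m hm => by
      simpa only [List.append_assoc] using h ([a] ++ u) m hm) s

/-- The automaton `Au(v, r, k)`. Reading `a` leads from `⟨w⟩` to `⟨wa⟩` if that is a state, and
nowhere otherwise; the initial state is the class of the empty word; all states are final. -/
def Au {k ℓ : ℕ} (v : Fin ℓ → Fin k) (r : ℕ) : NFA (Fin k) (State v r) where
  step s a := {t | appendLetter v r s.1 a = t.1}
  start := {s | s.1 = wordClass v r []}
  accept := Set.univ

/-- There is an edge from `s` to `t` in the graph of the automaton. -/
def Edge {k ℓ : ℕ} (v : Fin ℓ → Fin k) (r : ℕ) (s t : State v r) : Prop :=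
  ∃ a : Fin k, t ∈ (Au v r).step s a

/-- The number of loops (labelled edges from `s` to itself) at the state `s`. -/
noncomputable def numLoops {k ℓ : ℕ} (v : Fin ℓ → Fin k) (r : ℕ) (s : State v r) : ℕ :=
  Set.ncard {a : Fin k | s ∈ (Au v r).step s a}

/-- A simple path: a sequence of pairwise distinct states which starts at the initial state and in
which consecutive states are joined by edges. -/
structure IsSimplePath {k ℓ : ℕ} (v : Fin ℓ → Fin k) (r : ℕ) (p : List (State v r)) : Prop where
  start : ∃ s ∈ (Au v r).start, p.head? = some s
  chain : p.IsChain (Edge v r)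
  nodup : p.Nodup

/-- The number of states on `p` with exactly `d - 1` loops, `d` the number of letters of `v`. -/
noncomputable def numFullStates {k ℓ : ℕ} (v : Fin ℓ → Fin k) (r : ℕ) (p : List (State v r)) : ℕ :=
  p.countP (fun s => numLoops v r s = numLetters v - 1)

end PatternWords

namespace PatternWords

open Filter Topology Asymptotics

section GrowthOrder

variable {a b : ℕ → ℝ} {ρ : ℝ}

lemma isLittleO_of_linear_recurrence {e δ y d : ℕ → ℝ} (hρ : 0 ≤ ρ)
    (he : ∀ n, e (n + 1) = ρ * e n + δ n) (hy : ∀ n, y (n + 1) = ρ * y n + d n)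
    (hd : ∀ᶠ n in atTop, 0 ≤ d n) (hδ : δ =o[atTop] d)
    (hρy : ∀ N, (fun n => ρ ^ n) =o[atTop] fun n => y (n + N)) : e =o[atTop] y := by
  refine isLittleO_iff.2 fun c hc => ?_
  obtain ⟨N, hN⟩ := eventually_atTop.1 (hd.and (hδ.bound (half_pos hc)))
  have hexcess : ∀ n, |e (n + N)| - c / 2 * y (n + N) ≤ ρ ^ n * (|e N| - c / 2 * y N) := by
    intro n
    induction n with
    | zero => simp
    | succ n ih =>
      obtain ⟨hd0, hδd⟩ := hN (n + N) (Nat.le_add_left N n)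
      rw [Real.norm_eq_abs, Real.norm_of_nonneg hd0] at hδd
      have habs : |e (n + N + 1)| ≤ ρ * |e (n + N)| + |δ (n + N)| := by
        rw [he, ← abs_of_nonneg hρ, ← abs_mul, abs_of_nonneg hρ]
        exact abs_add_le _ _
      have hmul := mul_le_mul_of_nonneg_left ih hρ
      rw [add_right_comm, hy, pow_succ']
      linarith
  have hsmall := ((hρy N).const_mul_left (|e N| - c / 2 * y N)).bound (half_pos hc)
  rw [← map_add_atTop_eq_nat N, eventually_map]
  filter_upwards [hsmall] with n hn
  simp only [Real.norm_eq_abs] at hn ⊢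
  have hle_abs := mul_le_mul_of_nonneg_left (le_abs_self (y (n + N))) (half_pos hc).le
  linarith [hexcess n, le_abs_self ((|e N| - c / 2 * y N) * ρ ^ n)]

lemma tendsto_div_of_linear_recurrence {y d : ℕ → ℝ} {L : ℝ} (hρ : 0 ≤ ρ)
    (ha : ∀ n, a (n + 1) = ρ * a n + b n) (hy : ∀ n, y (n + 1) = ρ * y n + d n)
    (hd : ∀ᶠ n in atTop, 0 < d n) (hy0 : ∀ᶠ n in atTop, y n ≠ 0)
    (hρy : ∀ N, (fun n => ρ ^ n) =o[atTop] fun n => y (n + N))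
    (hb : Tendsto (fun n => b n / d n) atTop (𝓝 L)) :
    Tendsto (fun n => a n / y n) atTop (𝓝 L) := by
  have hδ : (fun n => b n - L * d n) =o[atTop] d := by
    refine (isLittleO_iff_tendsto' (hd.mono fun n hn h => absurd h hn.ne')).2 ?_
    refine ((hb.sub_const L).congr' ?_).trans (by rw [sub_self])
    filter_upwards [hd] with n hn
    field_simp
  have he : (fun n => a n - L * y n) =o[atTop] y :=
    isLittleO_of_linear_recurrence hρ (fun n => by rw [ha, hy]; ring) hy
      (hd.mono fun _ => le_of_lt) hδ hρy
  refine ((he.tendsto_div_nhds_zero.add_const L).congr' ?_).trans (by rw [zero_add])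
  filter_upwards [hy0] with n hn
  field_simp
  ring

lemma tendsto_div_pow_of_linear_recurrence {p q : ℕ} {β κ : ℝ} (hρ : 0 ≤ ρ)
    (ha : ∀ n, a (n + 1) = ρ * a n + b n)
    (hρq : ∀ N : ℕ, (fun n => ρ ^ n) =o[atTop] fun n : ℕ => ((n + N : ℕ) : ℝ) ^ q)
    (hκ : 0 < κ)
    (hq : Tendsto (fun n : ℕ => (((n : ℝ) + 1) ^ q - ρ * (n : ℝ) ^ q) / (n : ℝ) ^ p) atTop (𝓝 κ))
    (hb : Tendsto (fun n : ℕ => b n / (n : ℝ) ^ p) atTop (𝓝 β)) :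
    Tendsto (fun n : ℕ => a n / (n : ℝ) ^ q) atTop (𝓝 (β / κ)) := by
  have hpos : ∀ᶠ n : ℕ in atTop, (0 : ℝ) < n := by
    filter_upwards [eventually_gt_atTop 0] with n hn using Nat.cast_pos.2 hn
  have hd : ∀ᶠ n : ℕ in atTop, 0 < ((n : ℝ) + 1) ^ q - ρ * (n : ℝ) ^ q := by
    filter_upwards [hq.eventually (lt_mem_nhds hκ), hpos] with n hn hn0
    exact (div_pos_iff_of_pos_right (pow_pos hn0 p)).1 hn
  refine tendsto_div_of_linear_recurrence hρ ha (fun n => by push_cast; ring) hd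
    (hpos.mono fun n hn => pow_ne_zero q hn.ne') hρq ?_
  refine (hb.div hq hκ.ne').congr' ?_
  filter_upwards [hpos] with n hn
  exact div_div_div_cancel_right₀ (pow_ne_zero p hn.ne') _ _

lemma tendsto_succ_pow_div_pow (p : ℕ) :
    Tendsto (fun n : ℕ => ((n : ℝ) + 1) ^ p / (n : ℝ) ^ p) atTop (𝓝 1) := by
  have h := ((tendsto_natCast_div_add_atTop (1 : ℝ)).inv₀ one_ne_zero).pow p
  simpa only [inv_div, div_pow, inv_one, one_pow] using h

lemma tendsto_succ_pow_sub_pow_div_pow (p : ℕ) :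
    Tendsto (fun n : ℕ => (((n : ℝ) + 1) ^ (p + 1) - (n : ℝ) ^ (p + 1)) / (n : ℝ) ^ p) atTop
      (𝓝 ((p : ℝ) + 1)) := by
  induction p with
  | zero => simp
  | succ p ih =>
    have h := (ih.add (tendsto_succ_pow_div_pow (p + 1)))
    push_cast
    refine h.congr' ?_
    filter_upwards [eventually_gt_atTop 0] with n hn
    have : (n : ℝ) ≠ 0 := Nat.cast_ne_zero.2 hn.ne'
    field_simp
    ring

lemma tendsto_div_pow_of_contracting_recurrence {p : ℕ} {β : ℝ} (hρ : 0 ≤ ρ) (hρ1 : ρ < 1)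
    (ha : ∀ n, a (n + 1) = ρ * a n + b n)
    (hb : Tendsto (fun n : ℕ => b n / (n : ℝ) ^ p) atTop (𝓝 β)) :
    Tendsto (fun n : ℕ => a n / (n : ℝ) ^ p) atTop (𝓝 (β / (1 - ρ))) := by
  refine tendsto_div_pow_of_linear_recurrence hρ ha (fun N => ?_) (sub_pos.2 hρ1) ?_ hb
  · have hone : (fun _ : ℕ => (1 : ℝ)) =O[atTop] fun n : ℕ => ((n + N : ℕ) : ℝ) ^ p := by
      refine IsBigO.of_bound 1 ?_
      filter_upwards [eventually_ge_atTop 1] with n hn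
      have h1 : (1 : ℝ) ≤ ((n + N : ℕ) : ℝ) ^ p := one_le_pow₀ (by exact_mod_cast le_add_right hn)
      rw [norm_one, one_mul]
      exact h1.trans (le_abs_self _)
    exact ((isLittleO_one_iff ℝ).2 (tendsto_pow_atTop_nhds_zero_of_lt_one hρ hρ1)).trans_isBigO hone
  · refine ((tendsto_succ_pow_div_pow p).sub_const ρ).congr' ?_
    filter_upwards [eventually_gt_atTop 0] with n hn
    have : (n : ℝ) ≠ 0 := Nat.cast_ne_zero.2 hn.ne'
    field_simp

lemma tendsto_div_pow_succ_of_accumulating_recurrence {p : ℕ} {β : ℝ}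
    (ha : ∀ n, a (n + 1) = a n + b n)
    (hb : Tendsto (fun n : ℕ => b n / (n : ℝ) ^ p) atTop (𝓝 β)) :
    Tendsto (fun n : ℕ => a n / (n : ℝ) ^ (p + 1)) atTop (𝓝 (β / (p + 1))) := by
  refine tendsto_div_pow_of_linear_recurrence zero_le_one (fun n => by rw [ha, one_mul])
    (fun N => ?_) (by positivity) (by simpa using tendsto_succ_pow_sub_pow_div_pow p) hb
  simp only [one_pow]
  refine isLittleO_const_left.2 (Or.inr (tendsto_norm_atTop_atTop.comp ?_))
  exact (tendsto_pow_atTop p.succ_ne_zero).comp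
    (tendsto_natCast_atTop_atTop.comp (tendsto_add_atTop_nat N))

lemma summable_of_contracting_recurrence (hρ : ρ < 1) (ha0 : ∀ n, 0 ≤ a n) (hb0 : ∀ n, 0 ≤ b n)
    (ha : ∀ n, a (n + 1) = ρ * a n + b n) (hb : Summable b) : Summable a := by
  refine summable_of_sum_range_le (c := (a 0 + ∑' i, b i) / (1 - ρ)) ha0 fun n => ?_
  rw [le_div_iff₀ (sub_pos.2 hρ)]
  have hsum_succ := Finset.sum_range_succ a n
  rw [Finset.sum_range_succ'] at hsum_succ
  simp only [ha, Finset.sum_add_distrib, ← Finset.mul_sum] at hsum_succ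
  linarith [hb.sum_le_tsum (Finset.range n) fun i _ => hb0 i, ha0 n]

/-- The order of growth of a sequence, on a scale shifted by one so that it has a bottom element:
order `0` means summable, and order `m + 1` means asymptotic to `c * n ^ m` for some `c > 0`. -/
def HasGrowthOrder (a : ℕ → ℝ) : ℕ → Prop
  | 0 => Summable a
  | m + 1 => ∃ c : ℝ, 0 < c ∧ Tendsto (fun n : ℕ => a n / (n : ℝ) ^ m) atTop (𝓝 c)

lemma HasGrowthOrder.tendsto_div_pow_zero {m p : ℕ} (h : HasGrowthOrder a m) (hm : m ≤ p) :
    Tendsto (fun n : ℕ => a n / (n : ℝ) ^ p) atTop (𝓝 0) := by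
  rcases m with _ | q
  · have hbound : (fun n : ℕ => a n / (n : ℝ) ^ p) =O[atTop] a := by
      refine IsBigO.of_bound 1 ?_
      filter_upwards [eventually_ge_atTop 1] with n hn
      have hn1 : (1 : ℝ) ≤ (n : ℝ) ^ p := one_le_pow₀ (by exact_mod_cast hn)
      rw [norm_div, Real.norm_of_nonneg (zero_le_one.trans hn1), one_mul]
      exact div_le_self (norm_nonneg _) hn1
    exact hbound.trans_tendsto (Summable.tendsto_atTop_zero h)
  · obtain ⟨c, -, hc⟩ := h
    have hpow : Tendsto (fun n : ℕ => (n : ℝ) ^ q / (n : ℝ) ^ p) atTop (𝓝 0) :=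
      (isLittleO_pow_pow_atTop_of_lt hm).tendsto_div_nhds_zero.comp tendsto_natCast_atTop_atTop
    refine ((hc.mul hpow).congr' ?_).trans (by rw [mul_zero])
    filter_upwards [eventually_gt_atTop 0] with n hn
    exact div_mul_div_cancel₀ (pow_ne_zero q (Nat.cast_ne_zero.2 hn.ne'))

lemma HasGrowthOrder.exists_tendsto {m p : ℕ} (h : HasGrowthOrder a m) (hm : m ≤ p + 1) :
    ∃ c : ℝ, 0 ≤ c ∧ (m = p + 1 → 0 < c) ∧
      Tendsto (fun n : ℕ => a n / (n : ℝ) ^ p) atTop (𝓝 c) := by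
  rcases hm.eq_or_lt with rfl | hlt
  · obtain ⟨c, hc, htendsto⟩ := h
    exact ⟨c, hc.le, fun _ => hc, htendsto⟩
  · exact ⟨0, le_rfl, fun he => absurd he hlt.ne, h.tendsto_div_pow_zero (Nat.lt_succ_iff.1 hlt)⟩

lemma HasGrowthOrder.sum {ι : Type*} {s : Finset ι} {a : ι → ℕ → ℝ} {w : ι → ℝ} {m : ι → ℕ}
    (hw : ∀ i ∈ s, 0 < w i) (h : ∀ i ∈ s, HasGrowthOrder (a i) (m i)) :
    HasGrowthOrder (fun n => ∑ i ∈ s, a i n * w i) (s.sup m) := by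
  rcases hp : s.sup m with _ | p
  · refine summable_sum fun i hi => Summable.mul_right _ ?_
    have hi0 : m i = 0 := Nat.le_zero.1 (hp ▸ Finset.le_sup hi)
    exact (hi0 ▸ h i hi : HasGrowthOrder (a i) 0)
  · have hle : ∀ i ∈ s, m i ≤ p + 1 := fun i hi => hp ▸ Finset.le_sup hi
    choose! c hc0 hcpos hct using fun i hi => (h i hi).exists_tendsto (hle i hi)
    have hs : s.Nonempty := Finset.nonempty_iff_ne_empty.2 fun he => by simp [he] at hp
    obtain ⟨i, hi, him⟩ := Finset.exists_mem_eq_sup s hs m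
    refine ⟨∑ i ∈ s, c i * w i, ?_, ?_⟩
    · exact Finset.sum_pos' (fun i hi => mul_nonneg (hc0 i hi) (hw i hi).le)
        ⟨i, hi, mul_pos (hcpos i hi (him ▸ hp)) (hw i hi)⟩
    · refine (tendsto_finsetSum s fun i hi => (hct i hi).mul_const (w i)).congr fun n => ?_
      simp only [Finset.sum_div, div_mul_eq_mul_div]

lemma HasGrowthOrder.of_contracting_recurrence {m : ℕ} (hρ : 0 ≤ ρ) (hρ1 : ρ < 1)
    (ha0 : ∀ n, 0 ≤ a n) (hb0 : ∀ n, 0 ≤ b n) (ha : ∀ n, a (n + 1) = ρ * a n + b n)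
    (hb : HasGrowthOrder b m) : HasGrowthOrder a m := by
  rcases m with _ | p
  · exact summable_of_contracting_recurrence hρ1 ha0 hb0 ha hb
  · obtain ⟨β, hβ, htendsto⟩ := hb
    exact ⟨β / (1 - ρ), div_pos hβ (sub_pos.2 hρ1),
      tendsto_div_pow_of_contracting_recurrence hρ hρ1 ha htendsto⟩

lemma HasGrowthOrder.of_accumulating_recurrence {m : ℕ} (ha0 : ∃ n, 0 < a n)
    (hb0 : ∀ n, 0 ≤ b n) (ha : ∀ n, a (n + 1) = a n + b n) (hb : HasGrowthOrder b m) :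
    HasGrowthOrder a (m + 1) := by
  rcases m with _ | p
  · have hb' : Summable b := hb
    have hsum : ∀ n, a 0 + ∑ i ∈ Finset.range n, b i = a n := fun n => by
      rw [← add_sub_cancel (a 0) (a n), ← Finset.sum_range_sub]
      simp only [ha, add_sub_cancel_left]
    obtain ⟨N, hN⟩ := ha0
    refine ⟨a 0 + ∑' i, b i, ?_, ?_⟩
    · linarith [hb'.sum_le_tsum (Finset.range N) fun i _ => hb0 i, hsum N]
    · simpa only [pow_zero, div_one, hsum] using hb'.hasSum.tendsto_sum_nat.const_add (a 0)
  · obtain ⟨β, hβ, htendsto⟩ := hb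
    exact ⟨β / (p + 1), by positivity, tendsto_div_pow_succ_of_accumulating_recurrence ha htendsto⟩

end GrowthOrder

section Paths

variable {S : Type*} {E : S → S → Prop} {s t u : S} {p : List S} {c m : ℕ}

/-- A simple path from `s` to `t` in the graph of the relation `E`, as the list of its vertices. -/
structure IsSimplePathTo (E : S → S → Prop) (s t : S) (p : List S) : Prop where
  head?_eq : p.head? = some s
  getLast?_eq : p.getLast? = some t
  chain : p.IsChain E
  nodup : p.Nodup

/-- The numbers of vertices satisfying `Q` on the simple paths from `s` to `t`. -/
def pathCounts (E : S → S → Prop) (Q : S → Prop) [DecidablePred Q] (s t : S) : Set ℕ :=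
  {c | ∃ p, IsSimplePathTo E s t p ∧ p.countP Q = c}

lemma isSimplePathTo_singleton (E : S → S → Prop) (s : S) : IsSimplePathTo E s s [s] :=
  ⟨rfl, rfl, List.isChain_singleton s, List.nodup_singleton s⟩

section Order

variable [PartialOrder S]

lemma IsSimplePathTo.le_of_mem (hE : ∀ s t, E s t → s ≤ t) (h : IsSimplePathTo E s t p)
    (hu : u ∈ p) : u ≤ t := by
  obtain ⟨q, rfl⟩ := List.getLast?_eq_some_iff.1 h.getLast?_eq
  have hsorted : (q ++ [t]).Pairwise (· ≤ ·) := List.isChain_iff_pairwise.1 (h.chain.imp hE)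
  rcases List.mem_append.1 hu with hq | ht
  · exact (List.pairwise_append.1 hsorted).2.2 u hq t (List.mem_singleton_self t)
  · exact (List.mem_singleton.1 ht).le

lemma isSimplePathTo_concat (hE : ∀ s t, E s t → s ≤ t) (h : IsSimplePathTo E s u p)
    (hut : u ≠ t) (hEut : E u t) : IsSimplePathTo E s t (p ++ [t]) where
  head?_eq := by simp [h.head?_eq]
  getLast?_eq := List.getLast?_concat
  chain := List.isChain_append.2 ⟨h.chain, List.isChain_singleton t, by simp [h.getLast?_eq, hEut]⟩
  nodup := List.concat_eq_append ▸ h.nodup.concat fun ht =>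
    hut ((hE u t hEut).antisymm (h.le_of_mem hE ht))

lemma isSimplePathTo_iff (hE : ∀ s t, E s t → s ≤ t) : IsSimplePathTo E s t p ↔
    (s = t ∧ p = [t]) ∨ ∃ u q, u ≠ t ∧ E u t ∧ IsSimplePathTo E s u q ∧ p = q ++ [t] := by
  refine ⟨fun h => ?_, ?_⟩
  · obtain ⟨q, rfl⟩ := List.getLast?_eq_some_iff.1 h.getLast?_eq
    rcases q.eq_nil_or_concat' with rfl | ⟨q, u, rfl⟩
    · exact Or.inl ⟨(Option.some.inj h.head?_eq).symm, rfl⟩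
    · have hchain := List.isChain_append.1 h.chain
      have hnodup := (List.nodup_concat (q ++ [u]) t).1
        (by rw [List.concat_eq_append]; exact h.nodup)
      refine Or.inr ⟨u, _, ?_, hchain.2.2 u (by simp) t (by simp),
        ⟨?_, by simp, hchain.1, hnodup.2⟩, rfl⟩
      · rintro rfl
        exact hnodup.1 (by simp)
      · simpa using h.head?_eq
  · rintro (⟨rfl, rfl⟩ | ⟨u, q, hut, hEut, hq, rfl⟩)
    · exact isSimplePathTo_singleton E s
    · exact isSimplePathTo_concat hE hq hut hEut

variable {Q : S → Prop} [DecidablePred Q]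

lemma mem_pathCounts_iff (hE : ∀ s t, E s t → s ≤ t) : c ∈ pathCounts E Q s t ↔
    (s = t ∧ c = if Q t then 1 else 0) ∨
      ∃ u, u ≠ t ∧ E u t ∧ ∃ c' ∈ pathCounts E Q s u, c = c' + if Q t then 1 else 0 := by
  simp only [pathCounts, Set.mem_ofPred_eq, isSimplePathTo_iff hE (t := t)]
  constructor
  · rintro ⟨_, ⟨rfl, rfl⟩ | ⟨u, q, hut, hEut, hq, rfl⟩, rfl⟩
    · exact Or.inl ⟨rfl, by simp [List.countP_singleton]⟩
    · exact Or.inr ⟨u, hut, hEut, _, ⟨q, hq, rfl⟩, by simp [List.countP_singleton]⟩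
  · rintro (⟨rfl, rfl⟩ | ⟨u, hut, hEut, _, ⟨q, hq, rfl⟩, rfl⟩)
    · exact ⟨_, Or.inl ⟨rfl, rfl⟩, by simp [List.countP_singleton]⟩
    · exact ⟨_, Or.inr ⟨u, q, hut, hEut, hq, rfl⟩, by simp [List.countP_singleton]⟩

lemma exists_mem_pathCounts_of_reflTransGen (hE : ∀ s t, E s t → s ≤ t)
    (hc : c ∈ pathCounts E Q s u) (hut : Relation.ReflTransGen E u t) :
    ∃ c' ∈ pathCounts E Q s t, c ≤ c' ∧ (u ≠ t → Q t → c < c') := by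
  induction hut with
  | refl => exact ⟨c, hc, le_rfl, fun h => absurd rfl h⟩
  | @tail x t _ hxt ih =>
    obtain ⟨c', hc', hle, hlt⟩ := ih
    rcases eq_or_ne x t with rfl | hne
    · exact ⟨c', hc', hle, hlt⟩
    · refine ⟨_, (mem_pathCounts_iff hE).2 (Or.inr ⟨x, hne, hxt, c', hc', rfl⟩),
        le_add_right hle, fun _ hQ => ?_⟩
      rw [if_pos hQ]
      exact Nat.lt_succ_of_le hle

lemma pathCounts_nonempty_iff (hE : ∀ s t, E s t → s ≤ t) :
    (pathCounts E Q s t).Nonempty ↔ Relation.ReflTransGen E s t := by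
  constructor
  · rintro ⟨_, p, hp, rfl⟩
    obtain ⟨l, rfl⟩ := List.head?_eq_some_iff.1 hp.head?_eq
    refine List.relationReflTransGen_of_exists_isChain_cons l hp.chain ?_
    exact Option.some.inj ((List.getLast?_eq_getLast_of_ne_nil _).symm.trans hp.getLast?_eq)
  · intro h
    obtain ⟨c, hc, -⟩ := exists_mem_pathCounts_of_reflTransGen (Q := Q) hE
      ⟨[s], isSimplePathTo_singleton E s, rfl⟩ h
    exact ⟨c, hc⟩

lemma exists_isGreatest_pathCounts [Finite S] (hE : ∀ s t, E s t → s ≤ t)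
    (h : Relation.ReflTransGen E s t) : ∃ m, IsGreatest (pathCounts E Q s t) m := by
  have := Fintype.ofFinite S
  refine BddAbove.exists_isGreatest_of_nonempty ⟨Fintype.card S, ?_⟩
    ((pathCounts_nonempty_iff hE).2 h)
  rintro _ ⟨p, hp, rfl⟩
  exact List.countP_le_length.trans hp.nodup.length_le_card

lemma eq_sup_add_of_isGreatest_pathCounts {P : Finset S} {μ : S → ℕ} (hE : ∀ s t, E s t → s ≤ t)
    (hP : ∀ u, u ∈ P ↔ u ≠ t ∧ E u t ∧ Relation.ReflTransGen E s u)
    (hμ : ∀ u ∈ P, IsGreatest (pathCounts E Q s u) (μ u))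
    (hm : IsGreatest (pathCounts E Q s t) m) : m = P.sup μ + if Q t then 1 else 0 := by
  refine le_antisymm ?_ ?_
  · rcases (mem_pathCounts_iff hE).1 hm.1 with ⟨-, rfl⟩ | ⟨u, hut, hEut, c, hc, rfl⟩
    · exact Nat.le_add_left _ _
    · have hu : u ∈ P := (hP u).2 ⟨hut, hEut, (pathCounts_nonempty_iff hE).1 ⟨c, hc⟩⟩
      gcongr
      exact ((hμ u hu).2 hc).trans (Finset.le_sup hu)
  · rcases P.eq_empty_or_nonempty with rfl | hne
    · rcases (mem_pathCounts_iff hE).1 hm.1 with ⟨-, rfl⟩ | ⟨u, hut, hEut, c, hc, rfl⟩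
      · simp
      · exact absurd ((hP u).2 ⟨hut, hEut, (pathCounts_nonempty_iff hE).1 ⟨c, hc⟩⟩) (by simp)
    · obtain ⟨u, hu, hsup⟩ := P.exists_mem_eq_sup hne μ
      obtain ⟨hut, hEut, -⟩ := (hP u).1 hu
      exact hm.2 ((mem_pathCounts_iff hE).2 (Or.inr ⟨u, hut, hEut, _, (hμ u hu).1, by rw [hsup]⟩))

end Order

end Paths

section TriangularMatrix

variable {S : Type*} [Fintype S] [DecidableEq S] {s t : S}

section OrderedSemiring

variable {R : Type*} [Semiring R] [PartialOrder R] [IsStrictOrderedRing R] {A : Matrix S S R}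

lemma exists_pow_ne_zero_iff_reflTransGen (hA : ∀ s t, 0 ≤ A s t) :
    (∃ n, (A ^ n) s t ≠ 0) ↔ Relation.ReflTransGen (fun s t => A s t ≠ 0) s t := by
  constructor
  · rintro ⟨n, hn⟩
    induction n generalizing t with
    | zero =>
      obtain rfl : s = t := by simpa [Matrix.one_apply] using hn
      exact .refl
    | succ n ih =>
      rw [pow_succ, Matrix.mul_apply] at hn
      obtain ⟨u, -, hu⟩ := Finset.exists_ne_zero_of_sum_ne_zero hn
      exact (ih (left_ne_zero_of_mul hu)).tail (right_ne_zero_of_mul hu)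
  · intro h
    induction h with
    | refl => exact ⟨0, by simp⟩
    | @tail u t _ hut ih =>
      obtain ⟨n, hn⟩ := ih
      refine ⟨n + 1, ne_of_gt ?_⟩
      rw [pow_succ, Matrix.mul_apply]
      exact Finset.sum_pos' (fun x _ => mul_nonneg (Matrix.pow_apply_nonneg hA n s x) (hA x t))
        ⟨u, Finset.mem_univ u, mul_pos ((Matrix.pow_apply_nonneg hA n s u).lt_of_ne' hn)
          ((hA u t).lt_of_ne' hut)⟩

lemma pow_succ_apply_eq_add_sum {P : Finset S} (hA : ∀ s t, 0 ≤ A s t)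
    (hP : ∀ u, u ∈ P ↔ u ≠ t ∧ A u t ≠ 0 ∧ Relation.ReflTransGen (fun s t => A s t ≠ 0) s u)
    (n : ℕ) : (A ^ (n + 1)) s t = (A ^ n) s t * A t t + ∑ u ∈ P, (A ^ n) s u * A u t := by
  rw [pow_succ, Matrix.mul_apply, ← Finset.add_sum_erase _ _ (Finset.mem_univ t)]
  congr 1
  refine (Finset.sum_subset (fun u hu => ?_) fun u hu huP => ?_).symm
  · exact Finset.mem_erase.2 ⟨((hP u).1 hu).1, Finset.mem_univ u⟩
  · by_contra hne
    exact huP ((hP u).2 ⟨(Finset.mem_erase.1 hu).1, right_ne_zero_of_mul hne,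
      (exists_pow_ne_zero_iff_reflTransGen hA).1 ⟨n, left_ne_zero_of_mul hne⟩⟩)

end OrderedSemiring

theorem hasGrowthOrder_matrix_pow_apply [PartialOrder S] {A : Matrix S S ℝ} (hA : ∀ s t, 0 ≤ A s t)
    (hle : ∀ s t, A s t ≠ 0 → s ≤ t) (hdiag : ∀ t, A t t ≤ 1) {m : ℕ}
    (hm : IsGreatest (pathCounts (fun s t => A s t ≠ 0) (fun u => A u u = 1) s t) m) :
    HasGrowthOrder (fun n => (A ^ n) s t) m := by
  classical
  induction t using WellFoundedLT.induction generalizing m with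
  | ind t ih =>
    set P : Finset S := {u | u ≠ t ∧ A u t ≠ 0 ∧ Relation.ReflTransGen (fun s t => A s t ≠ 0) s u}
    have hP : ∀ u, u ∈ P ↔ u ≠ t ∧ A u t ≠ 0 ∧ Relation.ReflTransGen (fun s t => A s t ≠ 0) s u :=
      fun u => by simp [P]
    choose! μ hμ using fun u (hu : u ∈ P) =>
      exists_isGreatest_pathCounts (Q := fun u => A u u = 1) hle ((hP u).1 hu).2.2
    have hsum : HasGrowthOrder (fun n => ∑ u ∈ P, (A ^ n) s u * A u t) (P.sup μ) := by
      refine HasGrowthOrder.sum (fun u hu => (hA u t).lt_of_ne' ((hP u).1 hu).2.1) fun u hu => ?_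
      exact ih u ((hle u t ((hP u).1 hu).2.1).lt_of_ne ((hP u).1 hu).1) (hμ u hu)
    have hsum_nonneg : ∀ n, 0 ≤ ∑ u ∈ P, (A ^ n) s u * A u t := fun n =>
      Finset.sum_nonneg fun u _ => mul_nonneg (Matrix.pow_apply_nonneg hA n s u) (hA u t)
    have hrec := pow_succ_apply_eq_add_sum hA hP
    obtain rfl := eq_sup_add_of_isGreatest_pathCounts hle hP hμ hm
    rcases (hdiag t).eq_or_lt with h1 | h1
    · obtain ⟨n, hn⟩ := (exists_pow_ne_zero_iff_reflTransGen hA).2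
        ((pathCounts_nonempty_iff hle).1 hm.nonempty)
      rw [if_pos h1]
      exact .of_accumulating_recurrence
        ⟨n, (Matrix.pow_apply_nonneg hA n s t).lt_of_ne' hn⟩ hsum_nonneg
        (by simpa only [h1, mul_one] using hrec) hsum
    · rw [if_neg h1.ne]
      exact .of_contracting_recurrence (hA t t) h1
        (fun n => Matrix.pow_apply_nonneg hA n s t) hsum_nonneg
        (fun n => by rw [hrec, mul_comm]) hsum

end TriangularMatrix

section Subword

lemma sublist_finRange_iff {n : ℕ} {z : List (Fin n)} :
    z.Sublist (List.finRange n) ↔ z.SortedLT := by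
  constructor
  · exact fun h => ((List.sortedLT_finRange n).pairwise.sublist h).sortedLT
  · exact fun h => List.sublist_of_subperm_of_sortedLE
      (h.nodup.subperm fun i _ => List.mem_finRange i) h.sortedLE
      (List.sortedLT_finRange n).sortedLE

lemma card_orderEmbedding_get_eq {α : Type*} {m : ℕ} (x : Fin m → α) (w : List α) :
    Nat.card {j : Fin m ↪o Fin w.length // ∀ p, w.get (j p) = x p} =
      Nat.card {z : List (Fin w.length) // z.SortedLT ∧ z.map w.get = List.ofFn x} := by
  refine Nat.card_eq_of_bijective (fun j => ⟨List.ofFn j.1, j.1.strictMono.sortedLT_ofFn, ?_⟩)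
    ⟨fun i j hij => ?_, ?_⟩
  · rw [List.map_ofFn]
    exact congrArg List.ofFn (funext j.2)
  · exact Subtype.ext (DFunLike.coe_injective (List.ofFn_injective (congrArg Subtype.val hij)))
  · rintro ⟨z, hz, hzx⟩
    obtain rfl : m = z.length := by simpa using (congrArg List.length hzx).symm
    have hx : w.get ∘ z.get = x :=
      List.ofFn_injective (by rw [← hzx, ← List.map_ofFn, List.ofFn_get])
    exact ⟨⟨OrderEmbedding.ofStrictMono z.get hz, congrFun hx⟩, Subtype.ext (List.ofFn_get z)⟩

variable {α : Type*} [DecidableEq α] {w w' y : List α}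

/-- The number of ways to obtain `y` from `w` by deleting letters. -/
def subwordCount (y w : List α) : ℕ :=
  w.sublists.count y

lemma subwordCount_pos_iff : 0 < subwordCount y w ↔ y.Sublist w := by
  rw [subwordCount, List.count_pos_iff, List.mem_sublists]

lemma subwordCount_mono (h : w.Sublist w') (y : List α) : subwordCount y w ≤ subwordCount y w' := by
  rw [subwordCount, subwordCount, (List.sublists_perm_sublists' w).count_eq,
    (List.sublists_perm_sublists' w').count_eq]
  exact h.sublists'.count_le y

lemma subwordCount_nil (w : List α) : subwordCount [] w = 1 := by
  induction w using List.reverseRecOn with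
  | nil => rfl
  | append_singleton w a ih =>
    rw [subwordCount, List.sublists_concat, List.count_append, ← subwordCount, ih,
      List.count_eq_zero.2 (by simp)]

lemma subwordCount_concat_concat (y w : List α) (a b : α) :
    subwordCount (y ++ [b]) (w ++ [a]) =
      subwordCount (y ++ [b]) w + if a = b then subwordCount y w else 0 := by
  rw [subwordCount, List.sublists_concat, List.count_append]
  congr 1
  split_ifs with hab
  · rw [hab, List.count_map_of_injective _ _ (List.append_left_injective [b]), subwordCount]
  · rw [List.count_eq_zero]
    simp [hab]

lemma subwordCount_lt_append_self (hy : y ≠ []) (w : List α) :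
    subwordCount y w < subwordCount y (w ++ y) := by
  obtain ⟨z, b, rfl⟩ := (List.eq_nil_or_concat' y).resolve_left hy
  rw [← List.append_assoc, subwordCount_concat_concat, if_pos rfl]
  have hmono := subwordCount_mono (List.sublist_append_left w z) (z ++ [b])
  have hpos := subwordCount_pos_iff.2 (List.sublist_append_right w z)
  omega

lemma subwordCount_ofFn {m : ℕ} (x : Fin m → α) (w : List α) :
    subwordCount (List.ofFn x) w =
      Nat.card {j : Fin m ↪o Fin w.length // ∀ p, w.get (j p) = x p} := by
  have hnodup := List.nodup_sublists.2 (List.nodup_finRange w.length)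
  rw [card_orderEmbedding_get_eq, Nat.subtype_card ((List.finRange w.length).sublists.filter
      fun z => z.map w.get == List.ofFn x).toFinset fun z => by
        simp [sublist_finRange_iff],
    List.toFinset_card_of_nodup (hnodup.filter _), ← List.countP_eq_length_filter]
  conv_lhs =>
    rw [← List.map_get_finRange w, subwordCount, List.sublists_map, List.count, List.countP_map]
  rfl

/-- The numbers of times the words of length at most `ℓ` are subwords of `w`, cut off at `R`. -/
def truncatedSubwordCounts (ℓ R : ℕ) (w : List α) : {y : List α // y.length ≤ ℓ} → Fin (R + 1) :=
  fun y => ⟨min R (subwordCount y.1 w), Nat.lt_succ_of_le (min_le_left _ _)⟩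

lemma truncatedSubwordCounts_eq_iff {ℓ R : ℕ} :
    truncatedSubwordCounts ℓ R w = truncatedSubwordCounts ℓ R w' ↔
      ∀ y : List α, y.length ≤ ℓ → min R (subwordCount y w) = min R (subwordCount y w') := by
  simp only [funext_iff, Subtype.forall, truncatedSubwordCounts, Fin.mk.injEq]

lemma truncatedSubwordCounts_append {ℓ R : ℕ}
    (h : truncatedSubwordCounts ℓ R w = truncatedSubwordCounts ℓ R w') (u : List α) :
    truncatedSubwordCounts ℓ R (w ++ u) = truncatedSubwordCounts ℓ R (w' ++ u) := by
  induction u using List.reverseRecOn with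
  | nil => simpa only [List.append_nil] using h
  | append_singleton u a ih =>
    rw [truncatedSubwordCounts_eq_iff] at ih ⊢
    intro y hy
    obtain rfl | ⟨z, b, rfl⟩ := y.eq_nil_or_concat'
    · rw [subwordCount_nil, subwordCount_nil]
    · have hzb := ih (z ++ [b]) hy
      have hz := ih z (by simp at hy; omega)
      simp only [← List.append_assoc, subwordCount_concat_concat]
      split_ifs <;> omega

end Subword

section Occurrences

/-- The words `x` and `v` have the same comparisons between letters, so that `x` is a copy of the
pattern `v`. -/
def IsOrderIsomorphic {ι α β : Type*} [LT α] [LT β] (x : ι → α) (v : ι → β) : Prop :=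
  ∀ p q, (x p < x q ↔ v p < v q) ∧ (x p = x q ↔ v p = v q)

variable {k ℓ : ℕ} {v x : Fin ℓ → Fin k} {w w' : List (Fin k)}

open Classical in
lemma occ_eq_sum (v : Fin ℓ → Fin k) (w : List (Fin k)) :
    occ v w = ∑ x : {x : Fin ℓ → Fin k // IsOrderIsomorphic x v},
      subwordCount (List.ofFn x.1) w := by
  let e : Occurrence v w ≃ Σ x : {x : Fin ℓ → Fin k // IsOrderIsomorphic x v},
      {j : Fin ℓ ↪o Fin w.length // ∀ p, w.get (j p) = x.1 p} :=
    { toFun := fun j => ⟨⟨fun p => w.get (j.1 p), j.2⟩, j.1, fun _ => rfl⟩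
      invFun := fun xj => ⟨xj.2.1, fun p q => by simpa only [xj.2.2] using xj.1.2 p q⟩
      left_inv := fun _ => rfl
      right_inv := by
        rintro ⟨⟨x, hx⟩, j, hj⟩
        obtain rfl : (fun p => w.get (j p)) = x := funext hj
        rfl }
  simp only [occ, Nat.card_congr e, Nat.card_sigma, subwordCount_ofFn]

lemma occ_mono (v : Fin ℓ → Fin k) (h : w.Sublist w') : occ v w ≤ occ v w' := by
  rw [occ_eq_sum, occ_eq_sum]
  exact Finset.sum_le_sum fun x _ => subwordCount_mono h _

lemma occ_le_occ_append (v : Fin ℓ → Fin k) (w u : List (Fin k)) : occ v w ≤ occ v (w ++ u) :=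
  occ_mono v (List.sublist_append_left w u)

lemma occ_eq_zero_iff :
    occ v w = 0 ↔ ∀ x, IsOrderIsomorphic x v → ¬ (List.ofFn x).Sublist w := by
  simp only [occ_eq_sum, Finset.sum_eq_zero_iff, Finset.mem_univ, true_imp_iff, Subtype.forall,
    ← subwordCount_pos_iff, Nat.pos_iff_ne_zero, not_not]

lemma occ_nil (hℓ : 0 < ℓ) (v : Fin ℓ → Fin k) : occ v [] = 0 :=
  occ_eq_zero_iff.2 fun x _ hx =>
    hℓ.ne' (by simpa using congrArg List.length (List.sublist_nil.1 hx))

lemma occ_lt_occ_append (hℓ : 0 < ℓ) (hx : IsOrderIsomorphic x v) (w : List (Fin k)) :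
    occ v w < occ v (w ++ List.ofFn x) := by
  classical
  rw [occ_eq_sum, occ_eq_sum]
  refine Finset.sum_lt_sum (fun y _ => subwordCount_mono (List.sublist_append_left _ _) _)
    ⟨⟨x, hx⟩, Finset.mem_univ _, subwordCount_lt_append_self (fun h => hℓ.ne' ?_) w⟩
  exact List.ofFn_eq_nil_iff.1 h

lemma min_sum_congr {ι : Type*} {s : Finset ι} {R : ℕ} {a b : ι → ℕ}
    (h : ∀ i ∈ s, min R (a i) = min R (b i)) : min R (∑ i ∈ s, a i) = min R (∑ i ∈ s, b i) := by
  classical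
  induction s using Finset.induction_on with
  | empty => rfl
  | insert i s hi ih =>
    rw [Finset.sum_insert hi, Finset.sum_insert hi]
    have hi := h i (Finset.mem_insert_self _ _)
    have hs := ih fun j hj => h j (Finset.mem_insert_of_mem hj)
    omega

lemma min_occ_congr {R : ℕ} (v : Fin ℓ → Fin k)
    (h : truncatedSubwordCounts ℓ R w = truncatedSubwordCounts ℓ R w') :
    min R (occ v w) = min R (occ v w') := by
  rw [occ_eq_sum, occ_eq_sum]
  exact min_sum_congr fun x _ => truncatedSubwordCounts_eq_iff.1 h _ List.length_ofFn.le

end Occurrences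

section Automaton

variable {k ℓ r : ℕ} {v : Fin ℓ → Fin k} {w w' u : List (Fin k)} {s t s₀ : State v r}

lemma wordClass_eq_iff : wordClass v r w = wordClass v r w' ↔
    ∀ u, min (r + 1) (occ v (w ++ u)) = min (r + 1) (occ v (w' ++ u)) := by
  rw [wordClass, wordClass, Quotient.eq]
  refine forall_congr' fun u => ⟨fun h => ?_, fun h m hm => by omega⟩
  have hw := h (occ v (w ++ u))
  have hw' := h (occ v (w' ++ u))
  omega

instance (v : Fin ℓ → Fin k) (r : ℕ) : Finite (WordClass v r) := by
  have : Finite {y : List (Fin k) // y.length ≤ ℓ} := List.finite_length_le (Fin k) ℓ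
  refine Finite.of_injective
    (fun s : WordClass v r => truncatedSubwordCounts ℓ (r + 1) s.out) fun s t h => ?_
  rw [← s.out_eq, ← t.out_eq]
  exact wordClass_eq_iff.2 fun u => min_occ_congr v (truncatedSubwordCounts_append h u)

/-- The numbers of occurrences of `v` in the continuations of a word, cut off at `r + 1`, as a
function of the class of the word. -/
noncomputable def profile (s : WordClass v r) : List (Fin k) → ℕ :=
  Quotient.lift (s := wordSetoid v r) (fun w u => min (r + 1) (occ v (w ++ u)))
    (fun _ _ h => funext (wordClass_eq_iff.1 (Quotient.sound h))) s

lemma profile_wordClass (v : Fin ℓ → Fin k) (r : ℕ) (w u : List (Fin k)) :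
    profile (wordClass v r w) u = min (r + 1) (occ v (w ++ u)) := rfl

lemma profile_injective : Function.Injective (profile (v := v) (r := r)) := by
  intro s t h
  obtain ⟨w, rfl⟩ := Quotient.exists_rep s
  obtain ⟨w', rfl⟩ := Quotient.exists_rep t
  exact wordClass_eq_iff.2 (congrFun h)

-- A separate `LE` instance takes precedence over the order that Mathlib puts on quotients.
noncomputable instance (v : Fin ℓ → Fin k) (r : ℕ) : LE (WordClass v r) :=
  ⟨fun s t => profile s ≤ profile t⟩

noncomputable instance (v : Fin ℓ → Fin k) (r : ℕ) : PartialOrder (WordClass v r) :=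
  PartialOrder.lift profile profile_injective

lemma wordClass_le_append (v : Fin ℓ → Fin k) (r : ℕ) (w u : List (Fin k)) :
    wordClass v r w ≤ wordClass v r (w ++ u) := fun x =>
  min_le_min le_rfl (occ_mono v ((List.sublist_append_left w u).append_right x))

lemma min_occ_eq_of_wordClass_eq (h : wordClass v r w = wordClass v r w') :
    min (r + 1) (occ v w) = min (r + 1) (occ v w') := by
  simpa only [List.append_nil] using wordClass_eq_iff.1 h []

lemma occ_le_of_wordClass_eq (h : wordClass v r w = t.1) : occ v w ≤ r := by
  obtain ⟨w', hw', ht⟩ := t.2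
  have := min_occ_eq_of_wordClass_eq (h.trans ht.symm)
  omega

lemma wordClass_append_congr (h : wordClass v r w = wordClass v r w') (u : List (Fin k)) :
    wordClass v r (w ++ u) = wordClass v r (w' ++ u) := by
  rw [wordClass_eq_iff] at h ⊢
  simpa only [List.append_assoc] using fun x => h (u ++ x)

lemma mem_step_iff (h : wordClass v r w = s.1) {a : Fin k} :
    t ∈ (Au v r).step s a ↔ wordClass v r (w ++ [a]) = t.1 := by
  change appendLetter v r s.1 a = t.1 ↔ _
  rw [← h]
  rfl

lemma le_of_edge (h : Edge v r s t) : s ≤ t := by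
  obtain ⟨a, ha⟩ := h
  obtain ⟨w, -, hw⟩ := s.2
  rw [mem_step_iff hw] at ha
  rw [← Subtype.coe_le_coe, ← hw, ← ha]
  exact wordClass_le_append v r w [a]

lemma reflTransGen_edge_of_wordClass_append (hs : wordClass v r w = s.1)
    (ht : wordClass v r (w ++ u) = t.1) : Relation.ReflTransGen (Edge v r) s t := by
  induction u using List.reverseRecOn generalizing t with
  | nil =>
    rw [List.append_nil, hs] at ht
    rw [Subtype.ext ht]
  | append_singleton u a ih =>
    rw [← List.append_assoc] at ht
    have hocc := (occ_le_occ_append v (w ++ u) [a]).trans (occ_le_of_wordClass_eq ht)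
    exact (ih (t := ⟨_, w ++ u, hocc, rfl⟩) rfl).tail ⟨a, (mem_step_iff rfl).2 ht⟩

lemma reflTransGen_edge_of_mem_start (hs₀ : s₀ ∈ (Au v r).start) (t : State v r) :
    Relation.ReflTransGen (Edge v r) s₀ t := by
  obtain ⟨w, -, ht⟩ := t.2
  exact reflTransGen_edge_of_wordClass_append (w := []) hs₀.symm ht

lemma exists_mem_start (hℓ : 0 < ℓ) (v : Fin ℓ → Fin k) (r : ℕ) : ∃ s₀, s₀ ∈ (Au v r).start :=
  ⟨⟨_, [], (occ_nil hℓ v).trans_le r.zero_le, rfl⟩, rfl⟩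

lemma isSimplePath_iff (hs₀ : s₀ ∈ (Au v r).start) {p : List (State v r)} :
    IsSimplePath v r p ↔ ∃ t, IsSimplePathTo (Edge v r) s₀ t p := by
  constructor
  · rintro ⟨⟨s, hs, hhead⟩, hchain, hnodup⟩
    have hp : p ≠ [] := by
      rintro rfl
      cases hhead
    rw [show s = s₀ from Subtype.ext (hs.trans hs₀.symm)] at hhead
    exact ⟨p.getLast hp, hhead, List.getLast?_eq_getLast_of_ne_nil hp, hchain, hnodup⟩
  · rintro ⟨t, h⟩
    exact ⟨⟨s₀, hs₀, h.head?_eq⟩, h.chain, h.nodup⟩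

end Automaton

section Loops

variable {k ℓ r : ℕ} {v : Fin ℓ → Fin k} {w u : List (Fin k)} {s t s₀ : State v r}

/-- The set of the letters of the pattern `v`. -/
abbrev letters (v : Fin ℓ → Fin k) : Finset (Fin k) :=
  Finset.univ.image v

/-- A state with the largest possible number `d - 1` of loops, `d` the number of letters of `v`. -/
abbrev IsFull (s : State v r) : Prop :=
  numLoops v r s = numLetters v - 1

lemma length_pos_of_numLetters_pos (hd : 0 < numLetters v) : 0 < ℓ := by
  obtain ⟨_, ha⟩ := Finset.card_pos.1 hd
  obtain ⟨p, -, -⟩ := Finset.mem_image.1 ha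
  exact p.pos

lemma exists_isOrderIsomorphic_mem {A : Finset (Fin k)} (hA : numLetters v ≤ A.card) :
    ∃ x : Fin ℓ → Fin k, IsOrderIsomorphic x v ∧ ∀ p, x p ∈ A := by
  let i : letters v ≃o Fin (numLetters v) := ((letters v).orderIsoOfFin rfl).symm
  have hv : ∀ p, v p ∈ letters v := fun p => Finset.mem_image_of_mem v (Finset.mem_univ p)
  refine ⟨fun p => A.orderEmbOfCardLe hA (i ⟨v p, hv p⟩), fun p q => ⟨?_, ?_⟩,
    fun p => A.orderEmbOfCardLe_mem hA _⟩
  · rw [OrderEmbedding.lt_iff_lt, OrderIso.lt_iff_lt, Subtype.mk_lt_mk]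
  · rw [EmbeddingLike.apply_eq_iff_eq, EmbeddingLike.apply_eq_iff_eq, Subtype.mk_eq_mk]

lemma eq_of_isOrderIsomorphic_of_mem {x : Fin ℓ → Fin k} (hx : IsOrderIsomorphic x v)
    (hmem : ∀ p, x p ∈ letters v) : x = v := by
  have hex : ∀ l : letters v, ∃ p, v p = l := fun l => by
    obtain ⟨p, -, hp⟩ := Finset.mem_image.1 l.2
    exact ⟨p, hp⟩
  choose c hc using hex
  let F : letters v → letters v := fun l => ⟨x (c l), hmem _⟩
  have hF : StrictMono F := fun l l' h => by
    rw [← Subtype.coe_lt_coe, (hx _ _).1, hc, hc]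
    exact h
  funext p
  let l : letters v := ⟨v p, Finset.mem_image_of_mem v (Finset.mem_univ p)⟩
  have hl : x (c l) = x p := (hx _ _).2.2 (hc l)
  rw [← hl]
  exact congrArg Subtype.val (le_antisymm hF.apply_le hF.le_apply : F l = l)

lemma occ_append_eq_zero (hℓ : 0 < ℓ) {b : Fin k} (hb : b ∈ letters v) {x y : List (Fin k)}
    (hx : ∀ a ∈ x, a ∈ (letters v).erase (v ⟨0, hℓ⟩)) (hy : ∀ a ∈ y, a ∈ (letters v).erase b) :
    occ v (x ++ y) = 0 := by
  refine occ_eq_zero_iff.2 fun x' hx' hsub => ?_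
  have hmem : ∀ a ∈ x ++ y, a ∈ letters v := fun a ha =>
    (List.mem_append.1 ha).elim (fun h => Finset.mem_of_mem_erase (hx a h))
      fun h => Finset.mem_of_mem_erase (hy a h)
  obtain rfl := eq_of_isOrderIsomorphic_of_mem hx' fun p =>
    hmem _ (hsub.subset (List.mem_ofFn.2 ⟨p, rfl⟩))
  obtain ⟨z₁, z₂, hz, hz₁, hz₂⟩ := List.sublist_append_iff.1 hsub
  have hz₁_nil : z₁ = [] := by
    by_contra hne
    refine (Finset.mem_erase.1 (hx _ (hz₁.subset (List.head_mem hne)))).1 ?_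
    rw [← List.head_append_of_ne_nil (w₁ := List.append_ne_nil_of_left_ne_nil hne z₂) hne]
    simp only [← hz, List.head_ofFn]
  have hbz : b ∈ z₂ := by
    rw [← List.nil_append z₂, ← hz₁_nil, ← hz, List.mem_ofFn]
    simpa using hb
  exact Finset.notMem_erase b _ (hy b (hz₂.subset hbz))

lemma wordClass_append_of_loops (h : ∀ a ∈ u, wordClass v r (w ++ [a]) = wordClass v r w) :
    wordClass v r (w ++ u) = wordClass v r w := by
  induction u with
  | nil => rw [List.append_nil]
  | cons a u ih =>
    rw [List.append_cons, wordClass_append_congr (h a List.mem_cons_self)]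
    exact ih fun b hb => h b (List.mem_cons_of_mem a hb)

lemma numLoops_lt_numLetters (hℓ : 0 < ℓ) (s : State v r) : numLoops v r s < numLetters v := by
  classical
  by_contra! h
  obtain ⟨w, hw, hs⟩ := s.2
  rw [numLoops, Set.ncard_eq_toFinset_card'] at h
  obtain ⟨x, hx, hmem⟩ := exists_isOrderIsomorphic_mem h
  have hclass : wordClass v r (w ++ List.ofFn x) = wordClass v r w :=
    wordClass_append_of_loops fun a ha => by
      obtain ⟨p, rfl⟩ := List.mem_ofFn.1 ha
      exact ((mem_step_iff hs).1 (Set.mem_toFinset (s := {a | s ∈ (Au v r).step s a}).1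
        (hmem p))).trans hs.symm
  have hlt := occ_lt_occ_append hℓ hx w
  have hmin := min_occ_eq_of_wordClass_eq hclass
  omega

lemma exists_append_loops (v : Fin ℓ → Fin k) (r : ℕ) (w : List (Fin k)) (A : Finset (Fin k)) :
    ∃ u : List (Fin k), (∀ a ∈ u, a ∈ A) ∧
      ∀ a ∈ A, wordClass v r (w ++ u ++ [a]) = wordClass v r (w ++ u) := by
  let X : Set (WordClass v r) := (fun u => wordClass v r (w ++ u)) '' {u | ∀ a ∈ u, a ∈ A}
  obtain ⟨_, ⟨u, hu, rfl⟩, hmax⟩ := X.toFinite.exists_maximal ⟨_, [], by simp, rfl⟩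
  refine ⟨u, hu, fun a ha => (hmax ⟨u ++ [a], ?_, ?_⟩ ?_).antisymm ?_⟩
  · simpa [or_imp, forall_and, ha] using hu
  · rw [List.append_assoc]
  all_goals exact wordClass_le_append v r _ _

lemma exists_append_loops_eq_erase (hℓ : 0 < ℓ) {b : Fin k} (hb : b ∈ letters v)
    (w : List (Fin k)) : ∃ u, (∀ a ∈ u, a ∈ (letters v).erase b) ∧
      ∀ s : State v r, wordClass v r (w ++ u) = s.1 →
        {a | s ∈ (Au v r).step s a} = (letters v).erase b := by
  obtain ⟨u, hu, hloop⟩ := exists_append_loops v r w ((letters v).erase b)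
  refine ⟨u, hu, fun s hs => (Set.eq_of_subset_of_ncard_le (fun a ha => ?_) ?_).symm⟩
  · exact (mem_step_iff hs).2 ((hloop a ha).trans hs)
  · rw [Set.ncard_coe_finset, Finset.card_erase_of_mem hb]
    exact Nat.le_sub_one_of_lt (numLoops_lt_numLetters hℓ s)

lemma isFull_of_loops_eq_erase {b : Fin k} (hb : b ∈ letters v)
    (h : {a | s ∈ (Au v r).step s a} = (letters v).erase b) : IsFull s := by
  rw [IsFull, numLoops, h, Set.ncard_coe_finset, Finset.card_erase_of_mem hb]
  rfl

-- First omit the first letter of `v`, then any other letter: no copy of `v` can be completed.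
lemma exists_isFull_ne_reflTransGen (hd : 1 < numLetters v) (r : ℕ) :
    ∃ s t : State v r, IsFull s ∧ IsFull t ∧ s ≠ t ∧ Relation.ReflTransGen (Edge v r) s t := by
  have hℓ := length_pos_of_numLetters_pos (zero_lt_one.trans hd)
  have hα : v ⟨0, hℓ⟩ ∈ letters v := Finset.mem_image_of_mem v (Finset.mem_univ _)
  obtain ⟨β, hβ, hne⟩ := Finset.exists_mem_ne hd (v ⟨0, hℓ⟩)
  obtain ⟨x, hx, hxloop⟩ := exists_append_loops_eq_erase (r := r) hℓ hα []
  obtain ⟨y, hy, hyloop⟩ := exists_append_loops_eq_erase (r := r) hℓ hβ x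
  have hxy : occ v (x ++ y) ≤ r := (occ_append_eq_zero hℓ hβ hx hy).trans_le r.zero_le
  let s : State v r := ⟨_, x, (occ_le_occ_append v x y).trans hxy, rfl⟩
  let t : State v r := ⟨_, x ++ y, hxy, rfl⟩
  have hs := hxloop s rfl
  have ht := hyloop t rfl
  refine ⟨s, t, isFull_of_loops_eq_erase hα hs, isFull_of_loops_eq_erase hβ ht, fun h => ?_,
    reflTransGen_edge_of_wordClass_append rfl rfl⟩
  rw [← h, hs, Finset.coe_inj] at ht
  exact Finset.notMem_erase β _ (ht ▸ Finset.mem_erase.2 ⟨hne, hβ⟩)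

lemma exists_two_le_mem_pathCounts (hd : 1 < numLetters v) (hs₀ : s₀ ∈ (Au v r).start) :
    ∃ t, ∃ c ∈ pathCounts (Edge v r) IsFull s₀ t, 2 ≤ c := by
  obtain ⟨s, t, hs, ht, hne, hst⟩ := exists_isFull_ne_reflTransGen hd r
  obtain ⟨_, p, hp, rfl⟩ := (pathCounts_nonempty_iff (Q := IsFull) fun _ _ => le_of_edge).2
    (reflTransGen_edge_of_mem_start hs₀ s)
  have hpos : 0 < p.countP fun u => IsFull u := List.countP_pos_iff.2
    ⟨s, List.mem_of_getLast? hp.getLast?_eq, by simpa using hs⟩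
  obtain ⟨c, hc, -, hlt⟩ := exists_mem_pathCounts_of_reflTransGen (fun _ _ => le_of_edge)
    (Q := IsFull) ⟨p, hp, rfl⟩ hst
  exact ⟨t, c, hc, (Nat.succ_le_of_lt hpos).trans_lt (hlt hne ht)⟩

end Loops

section TransferMatrix

variable {k ℓ r : ℕ} {v : Fin ℓ → Fin k} {s t s₀ : State v r}

/-- The words of length `n` that lead from the initial state to the state `t`. -/
def wordsTo (n : ℕ) (t : State v r) : Set (List (Fin k)) :=
  {w | w.length = n ∧ wordClass v r w = t.1}

lemma finite_wordsTo (n : ℕ) (t : State v r) : (wordsTo n t).Finite :=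
  (List.finite_length_eq (Fin k) n).subset fun _ h => h.1

lemma disjoint_wordsTo (n : ℕ) (h : s ≠ t) : Disjoint (wordsTo n s) (wordsTo n t) :=
  Set.disjoint_left.2 fun _ hs ht => h (Subtype.ext (hs.2.symm.trans ht.2))

lemma ncard_biUnion_wordsTo (T : Finset (State v r)) (n : ℕ) :
    (⋃ t ∈ T, wordsTo n t).ncard = ∑ t ∈ T, (wordsTo n t).ncard := by
  rw [← finsum_mem_coe_finset]
  exact T.finite_toSet.ncard_biUnion (fun t _ => finite_wordsTo n t)
    fun s _ t _ h => disjoint_wordsTo n h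

lemma ncard_wordsTo_succ [Fintype (State v r)] (n : ℕ) (t : State v r) :
    (wordsTo (n + 1) t).ncard =
      ∑ s, (wordsTo n s).ncard * {a | t ∈ (Au v r).step s a}.ncard := by
  let F : List (Fin k) × Fin k → List (Fin k) := fun z => z.1 ++ [z.2]
  have hF : Function.Injective F := fun y z h => by
    obtain ⟨hword, hletter⟩ := List.append_inj' h rfl
    exact Prod.ext hword (List.singleton_inj.1 hletter)
  have hunion : wordsTo (n + 1) t = ⋃ s, F '' (wordsTo n s ×ˢ {a | t ∈ (Au v r).step s a}) := by
    ext w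
    simp only [Set.mem_iUnion]
    constructor
    · rintro ⟨hn, ht⟩
      obtain ⟨u, a, rfl⟩ := (List.eq_nil_or_concat' w).resolve_left (by rintro rfl; simp at hn)
      have hocc := (occ_le_occ_append v u [a]).trans (occ_le_of_wordClass_eq ht)
      exact ⟨⟨_, u, hocc, rfl⟩, (u, a), ⟨⟨by simpa using hn, rfl⟩, (mem_step_iff rfl).2 ht⟩, rfl⟩
    · rintro ⟨s, ⟨u, a⟩, ⟨⟨hn, hs⟩, ha⟩, rfl⟩
      exact ⟨by simp [F, hn], (mem_step_iff hs).1 ha⟩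
  rw [hunion, Set.ncard_iUnion_of_finite
    (fun s => ((finite_wordsTo n s).prod (Set.toFinite _)).image F), finsum_eq_sum_of_fintype]
  · exact Finset.sum_congr rfl fun s _ => by rw [Set.ncard_image_of_injective _ hF, Set.ncard_prod]
  · exact fun s s' h => (Set.disjoint_image_iff hF).2
      (Set.disjoint_prod.2 (Or.inl (disjoint_wordsTo n h)))

/-- The matrix of the numbers of edges of the automaton, divided by `d - 1`, so that the diagonal
entry at a state is `1` iff the state has `d - 1` loops. -/
noncomputable def transferMatrix (v : Fin ℓ → Fin k) (r : ℕ) :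
    Matrix (State v r) (State v r) ℝ := fun s t =>
  {a | t ∈ (Au v r).step s a}.ncard / ((numLetters v : ℝ) - 1)

lemma transferMatrix_nonneg (hd : 1 < numLetters v) (s t : State v r) :
    0 ≤ transferMatrix v r s t :=
  div_nonneg (Nat.cast_nonneg _) (sub_nonneg.2 (by exact_mod_cast hd.le))

lemma transferMatrix_ne_zero_iff (hd : 1 < numLetters v) :
    transferMatrix v r s t ≠ 0 ↔ Edge v r s t := by
  have hd' : (numLetters v : ℝ) - 1 ≠ 0 := sub_ne_zero.2 (by exact_mod_cast hd.ne')
  rw [transferMatrix, div_ne_zero_iff, and_iff_left hd', Nat.cast_ne_zero,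
    Ne, Set.ncard_eq_zero, ← Ne, ← Set.nonempty_iff_ne_empty]
  rfl

lemma transferMatrix_self_le_one (hd : 1 < numLetters v) (t : State v r) :
    transferMatrix v r t t ≤ 1 := by
  have hd' : (0 : ℝ) < (numLetters v : ℝ) - 1 := sub_pos.2 (by exact_mod_cast hd)
  have hlt := numLoops_lt_numLetters (length_pos_of_numLetters_pos (zero_lt_one.trans hd)) t
  rw [transferMatrix, div_le_one hd', ← Nat.cast_one, ← Nat.cast_sub hd.le]
  exact Nat.cast_le.2 (Nat.le_sub_one_of_lt hlt)

lemma transferMatrix_self_eq_one_iff (hd : 1 < numLetters v) :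
    transferMatrix v r t t = 1 ↔ IsFull t := by
  have hd' : (numLetters v : ℝ) - 1 ≠ 0 := sub_ne_zero.2 (by exact_mod_cast hd.ne')
  rw [transferMatrix, div_eq_one_iff_eq hd', ← Nat.cast_one, ← Nat.cast_sub hd.le, Nat.cast_inj]
  rfl

lemma transferMatrix_pow_apply [Fintype (State v r)] [DecidableEq (State v r)]
    (hs₀ : s₀ ∈ (Au v r).start) (n : ℕ) (t : State v r) :
    (transferMatrix v r ^ n) s₀ t = (wordsTo n t).ncard / ((numLetters v : ℝ) - 1) ^ n := by
  induction n generalizing t with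
  | zero =>
    have hwords : wordsTo 0 t = if s₀ = t then {[]} else ∅ := by
      ext w
      rw [wordsTo, Set.mem_ofPred_eq, List.length_eq_zero_iff]
      split_ifs with h
      · exact and_iff_left_of_imp fun hw => by rw [hw, ← h, hs₀]
      · refine iff_of_false ?_ (Set.notMem_empty w)
        rintro ⟨rfl, ht⟩
        exact h (Subtype.ext (hs₀.trans ht))
    rw [pow_zero, pow_zero, Matrix.one_apply, hwords, div_one]
    split_ifs <;> simp
  | succ n ih =>
    rw [pow_succ, Matrix.mul_apply, ncard_wordsTo_succ, Nat.cast_sum, Finset.sum_div]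
    refine Finset.sum_congr rfl fun s _ => ?_
    rw [ih, transferMatrix, Nat.cast_mul, pow_succ, div_mul_div_comm]

lemma hasGrowthOrder_ncard_wordsTo (hd : 1 < numLetters v) (hs₀ : s₀ ∈ (Au v r).start) {m : ℕ}
    (hm : IsGreatest (pathCounts (Edge v r) IsFull s₀ t) m) :
    HasGrowthOrder (fun n => (wordsTo n t).ncard / ((numLetters v : ℝ) - 1) ^ n) m := by
  classical
  have := Fintype.ofFinite (State v r)
  simp_rw [← transferMatrix_pow_apply hs₀]
  refine hasGrowthOrder_matrix_pow_apply (transferMatrix_nonneg hd)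
    (fun s t h => le_of_edge ((transferMatrix_ne_zero_iff hd).1 h)) (transferMatrix_self_le_one hd)
    ?_
  convert hm using 5
  · exact transferMatrix_ne_zero_iff hd
  · exact transferMatrix_self_eq_one_iff hd

lemma f_eq_sum [Fintype (State v r)] {j : ℕ} (hj : j ≤ r) (n : ℕ) :
    f v j n = ∑ t : State v r with profile t.1 [] = j, (wordsTo n t).ncard := by
  rw [← ncard_biUnion_wordsTo, f]
  congr 1
  ext w
  simp only [Set.mem_iUnion, Finset.mem_filter, Finset.mem_univ, true_and]
  constructor
  · rintro ⟨hn, rfl⟩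
    refine ⟨⟨_, w, hj, rfl⟩, ?_, hn, rfl⟩
    rw [profile_wordClass, List.append_nil]
    omega
  · rintro ⟨t, ht, hn, hw⟩
    rw [← hw, profile_wordClass, List.append_nil] at ht
    exact ⟨hn, by omega⟩

lemma g_eq_sum [Fintype (State v r)] (n : ℕ) :
    g v r n = ∑ t : State v r, (wordsTo n t).ncard := by
  rw [g, ← Finset.sum_fiberwise_of_maps_to (t := Finset.range (r + 1))
    (g := fun t : State v r => profile t.1 [])]
  · exact Finset.sum_congr rfl fun j hj => f_eq_sum (Nat.lt_succ_iff.1 (Finset.mem_range.1 hj)) n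
  · rintro ⟨_, w, hw, rfl⟩ -
    rw [Finset.mem_range, profile_wordClass, List.append_nil]
    omega

lemma isGreatest_numFullStates [Fintype (State v r)] (hs₀ : s₀ ∈ (Au v r).start)
    {m : State v r → ℕ} (hm : ∀ t, IsGreatest (pathCounts (Edge v r) IsFull s₀ t) (m t)) :
    IsGreatest {c | ∃ p, IsSimplePath v r p ∧ c = numFullStates v r p} (Finset.univ.sup m) := by
  obtain ⟨t, -, ht⟩ := Finset.exists_mem_eq_sup Finset.univ ⟨s₀, Finset.mem_univ _⟩ m
  constructor
  · obtain ⟨p, hp, hcount⟩ := (hm t).1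
    exact ⟨p, (isSimplePath_iff hs₀).2 ⟨t, hp⟩, ht.trans hcount.symm⟩
  · rintro _ ⟨p, hp, rfl⟩
    obtain ⟨u, hu⟩ := (isSimplePath_iff hs₀).1 hp
    exact ((hm u).2 ⟨p, hu, rfl⟩).trans (Finset.le_sup (Finset.mem_univ u))

lemma exists_tendsto_sum_ncard_wordsTo (hd : 1 < numLetters v) (hs₀ : s₀ ∈ (Au v r).start)
    {T : Finset (State v r)} {m : State v r → ℕ} {M : ℕ}
    (hm : ∀ t ∈ T, IsGreatest (pathCounts (Edge v r) IsFull s₀ t) (m t)) (hM : T.sup m ≤ M + 1) :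
    ∃ c : ℝ, 0 ≤ c ∧ (T.sup m = M + 1 → 0 < c) ∧ Tendsto (fun n : ℕ =>
      ((∑ t ∈ T, (wordsTo n t).ncard : ℕ) : ℝ) / ((n : ℝ) ^ M * ((numLetters v : ℝ) - 1) ^ n))
      atTop (𝓝 c) := by
  have hgrowth := HasGrowthOrder.sum (w := 1) (fun _ _ => one_pos)
    fun t ht => hasGrowthOrder_ncard_wordsTo hd hs₀ (hm t ht)
  obtain ⟨c, hc, hpos, hlim⟩ := hgrowth.exists_tendsto hM
  refine ⟨c, hc, hpos, hlim.congr fun n => ?_⟩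
  simp only [Pi.one_apply, mul_one, ← Finset.sum_div]
  rw [div_div, mul_comm, Nat.cast_sum]

end TransferMatrix

end PatternWords

open PatternWords

theorem mainTheorem2 {k ℓ : ℕ} (v : Fin ℓ → Fin k) (hd : 1 < PatternWords.numLetters v) (r : ℕ) :
    ∃ M : ℕ, 1 ≤ M ∧
      IsGreatest {c : ℕ | ∃ p : List (PatternWords.State v r),
        PatternWords.IsSimplePath v r p ∧ c = PatternWords.numFullStates v r p} (M + 1) ∧
      ∃ C K : ℝ, 0 < C ∧ 0 ≤ K ∧
        Filter.Tendsto (fun n : ℕ => (PatternWords.g v r n : ℝ) /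
            ((n : ℝ) ^ M * ((PatternWords.numLetters v : ℝ) - 1) ^ n))
          Filter.atTop (nhds C) ∧
        Filter.Tendsto (fun n : ℕ => (PatternWords.f v r n : ℝ) /
            ((n : ℝ) ^ M * ((PatternWords.numLetters v : ℝ) - 1) ^ n))
          Filter.atTop (nhds K) := by
  classical
  have := Fintype.ofFinite (State v r)
  obtain ⟨s₀, hs₀⟩ := exists_mem_start (length_pos_of_numLetters_pos (zero_lt_one.trans hd)) v r
  choose m hm using fun t => exists_isGreatest_pathCounts (Q := IsFull)
    (fun _ _ => le_of_edge) (reflTransGen_edge_of_mem_start hs₀ t)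
  obtain ⟨t, c, hc, hc_two⟩ := exists_two_le_mem_pathCounts hd hs₀
  have htwo : 2 ≤ Finset.univ.sup m :=
    (hc_two.trans ((hm t).2 hc)).trans (Finset.le_sup (Finset.mem_univ t))
  obtain ⟨M, hM⟩ := Nat.exists_eq_add_of_le' (one_le_two.trans htwo)
  obtain ⟨C, -, hC, hg⟩ := exists_tendsto_sum_ncard_wordsTo hd hs₀ (fun t _ => hm t) hM.le
  obtain ⟨K, hK, -, hf⟩ := exists_tendsto_sum_ncard_wordsTo hd hs₀ (fun t _ => hm t)
    ((Finset.sup_mono (Finset.filter_subset (fun t => profile t.1 [] = r) Finset.univ)).trans hM.le)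
  refine ⟨M, by omega, hM ▸ isGreatest_numFullStates hs₀ hm, C, K, hC hM, hK, ?_, ?_⟩
  · simpa only [← g_eq_sum] using hg
  · simpa only [← f_eq_sum le_rfl] using hf
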